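/- Let $\mathcal H$ be a complex Hilbert space. For norm-closed subspaces $\mathfrak V,\mathfrak W\subseteq\mathcal B(\mathcal H)$, let $\mathfrak V\otimes^{eh}\mathfrak W$ (the extended Haagerup tensor product) be the space of all formal series $\sum_{i\in I}v_i\otimes w_i$ with $v_i\in\mathfrak V$ and $w_i\in\mathfrak W$, over an arbitrary index set $I$, such that $\sum_{i\in I}v_iv_i^*$ and $\sum_{i\in I}w_i^*w_i$ converge weak* in $\mathcal B(\mathcal H)$. Two such series $\sum_{i\in I}v_i\otimes w_i$ and $\sum_{j\in J}v_j'\otimes w_j'$ are the same element if $\sum_{i\in I}v_ixw_i=\sum_{j\in J}v_j'xw_j'$ (weak* convergent sums) for all $x\in\mathcal B(\mathcal H)$. The element $T=\sum_{i\in I}v_i\otimes w_i$ is identified with the bounded operator $x\mapsto\sum_{i\in I}v_ixw_i$ on $\mathcal B(\mathcal H)$. Under this identification $\mathfrak V\otimes^{eh}\mathfrak W$ is a linear subspace of $\mathcal B(\mathcal H)\otimes^{eh}\mathcal B(\mathcal H)$, and $\mathcal B(\mathcal H)\otimes^{eh}\mathcal B(\mathcal H)$ is a unital algebra under composition $\circ$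 of operators, so that $(a\otimes b)\circ(c\otimes d)=ac\otimes db$. **Proposition.** Let $\mathfrak A$ and $\mathfrak B$ be norm-closed (not necessarily unital) subalgebras of $\mathcal B(\mathcal H)$. Then $\mathfrak A\otimes^{eh}\mathfrak B$ is a (not necessarily unital) subalgebra of $\mathcal B(\mathcal H)\otimes^{eh}\mathcal B(\mathcal H)$. Moreover, if $\mathfrak V$ and $\mathfrak W$ are norm-closed subspaces of $\mathcal B(\mathcal H)$ with $av\in\mathfrak V$ for all $a\in\mathfrak A$, $v\in\mathfrak V$ (a left $\mathfrak A$-module in $\mathcal B(\mathcal H)$) and $wb\in\mathfrak W$ for all $w\in\mathfrak W$, $b\in\mathfrak B$ (a right $\mathfrak B$-module in $\mathcal B(\mathcal H)$), then $\mathfrak V\otimes^{eh}\mathfrak W$ is a left $\mathfrak A\otimes^{eh}\mathfrak B$-module in $\mathcal B(\mathcal H)\otimes^{eh}\mathcal B(\mathcal H)$: it is a linear subspace of $\mathcal B(\mathcal H)\otimes^{eh}\mathcal B(\mathcal H)$ and $T\circ S\in\mathfrak V\otimes^{eh}\mathfrak W$ for all $T\in\mathfrak A\otimes^{eh}\mathfrak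 B$ and $S\in\mathfrak V\otimes^{eh}\mathfrak W$. -/

import Mathlib

open scoped InnerProductSpace

noncomputable section

universe u

namespace ExtHaagerup

variable {H : Type u} [NormedAddCommGroup H] [InnerProductSpace ℂ H]

/-- The functional `x ↦ ∑ₙ ⟨x ξₙ, ηₙ⟩` on `B(H)`. As `ξ` and `η` run over the square-summable
sequences in `H`, these are exactly the elements of the predual `B(H)_*`. -/
def normalFunctional (ξ η : ℕ → H) (x : H →L[ℂ] H) : ℂ := ∑' n, ⟪η n, x (ξ n)⟫_ℂ

/-- The series `∑ i, f i` (the net of its finite partial sums) converges to `a` in the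
weak* topology of `B(H) = (B(H)_*)^*`. -/
def WeakStarHasSum {ι : Type*} (f : ι → H →L[ℂ] H) (a : H →L[ℂ] H) : Prop :=
  ∀ ξ η : ℕ → H, Summable (fun n => ‖ξ n‖ ^ 2) → Summable (fun n => ‖η n‖ ^ 2) →
    HasSum (fun i => normalFunctional ξ η (f i)) (normalFunctional ξ η a)

lemma summable_normalFunctional {ξ η : ℕ → H} (hξ : Summable (fun n => ‖ξ n‖ ^ 2))
    (hη : Summable (fun n => ‖η n‖ ^ 2)) (x : H →L[ℂ] H) :
    Summable (fun n => ⟪η n, x (ξ n)⟫_ℂ) := by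
  refine Summable.of_norm_bounded (g := fun n => ‖x‖ * (‖ξ n‖ ^ 2 + ‖η n‖ ^ 2))
    ((hξ.add hη).mul_left _) fun n => ?_
  have h1 := norm_inner_le_norm (𝕜 := ℂ) (η n) (x (ξ n))
  have h2 := x.le_opNorm (ξ n)
  have h3 : ‖η n‖ * ‖x (ξ n)‖ ≤ ‖η n‖ * (‖x‖ * ‖ξ n‖) := by gcongr
  have h4 : 0 ≤ ‖x‖ * (‖ξ n‖ ^ 2 + ‖η n‖ ^ 2 - ‖η n‖ * ‖ξ n‖) :=
    mul_nonneg (norm_nonneg _) (by nlinarith [sq_nonneg (‖ξ n‖ - ‖η n‖), sq_nonneg (‖ξ n‖), sq_nonneg (‖η n‖)])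
  nlinarith

lemma normalFunctional_add {ξ η : ℕ → H} (hξ : Summable (fun n => ‖ξ n‖ ^ 2))
    (hη : Summable (fun n => ‖η n‖ ^ 2)) (x y : H →L[ℂ] H) :
    normalFunctional ξ η (x + y) = normalFunctional ξ η x + normalFunctional ξ η y := by
  simp only [normalFunctional, add_apply, inner_add_right]
  exact (summable_normalFunctional hξ hη x).tsum_add (summable_normalFunctional hξ hη y)

lemma normalFunctional_smul (ξ η : ℕ → H) (c : ℂ) (x : H →L[ℂ] H) :
    normalFunctional ξ η (c • x) = c * normalFunctional ξ η x := by
  simp only [normalFunctional, smul_apply, inner_smul_right]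
  exact tsum_mul_left

lemma normalFunctional_single (ξ η : H) (x : H →L[ℂ] H) :
    normalFunctional (Pi.single 0 ξ) (Pi.single 0 η) x = ⟪η, x ξ⟫_ℂ := by
  rw [normalFunctional, tsum_eq_single 0]
  · simp
  · intro n hn
    simp [Pi.single_eq_of_ne hn]

lemma summable_single {E : Type*} [NormedAddCommGroup E] (ξ : E) : Summable (fun n => ‖(Pi.single 0 ξ : ℕ → E) n‖ ^ 2) :=
  summable_of_ne_finset_zero (s := {0}) fun n hn => by
    have : n ≠ 0 := by simpa using hn
    simp [Pi.single_eq_of_ne this]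

lemma WeakStarHasSum.inner {ι : Type*} {f : ι → H →L[ℂ] H} {a : H →L[ℂ] H}
    (h : WeakStarHasSum f a) (ξ η : H) : HasSum (fun i => ⟪η, f i ξ⟫_ℂ) ⟪η, a ξ⟫_ℂ := by
  simpa only [normalFunctional_single] using h _ _ (summable_single ξ) (summable_single η)

lemma WeakStarHasSum.unique {ι : Type*} {f : ι → H →L[ℂ] H} {a b : H →L[ℂ] H}
    (ha : WeakStarHasSum f a) (hb : WeakStarHasSum f b) : a = b :=
  ContinuousLinearMap.ext fun ξ => ext_inner_left ℂ fun η =>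
    (ha.inner ξ η).unique (hb.inner ξ η)

lemma WeakStarHasSum.sumElim {ι κ : Type*} {f : ι ⊕ κ → H →L[ℂ] H} {a b : H →L[ℂ] H}
    (ha : WeakStarHasSum (fun i => f (.inl i)) a) (hb : WeakStarHasSum (fun i => f (.inr i)) b) :
    WeakStarHasSum f (a + b) := fun ξ η hξ hη => by
  rw [normalFunctional_add hξ hη]
  exact HasSum.sum (ha ξ η hξ hη) (hb ξ η hξ hη)

lemma WeakStarHasSum.const_smul {ι : Type*} {f : ι → H →L[ℂ] H} {a : H →L[ℂ] H}
    (h : WeakStarHasSum f a) (c : ℂ) : WeakStarHasSum (fun i => c • f i) (c • a) :=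
  fun ξ η hξ hη => by
    simp only [normalFunctional_smul]
    exact (h ξ η hξ hη).mul_left c

lemma weakStarHasSum_empty {ι : Type*} [IsEmpty ι] (f : ι → H →L[ℂ] H) :
    WeakStarHasSum f 0 := fun ξ η _ _ => by
  have : normalFunctional ξ η (0 : H →L[ℂ] H) = 0 := by simp [normalFunctional]
  rw [this]
  exact hasSum_empty

lemma summable_column {ι : Type*} (C : H →L[ℂ] lp (fun _ : ι => H) 2) {ξ : ℕ → H}
    (hξ : Summable (fun n => ‖ξ n‖ ^ 2)) :
    Summable (fun p : ι × ℕ => ‖C (ξ p.2) p.1‖ ^ 2) := by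
  have hs (n : ℕ) : HasSum (fun i => ‖C (ξ n) i‖ ^ 2) (‖C (ξ n)‖ ^ 2) := by
    simpa using lp.hasSum_norm (p := 2) (by norm_num) (C (ξ n))
  have h : Summable (fun p : ℕ × ι => ‖C (ξ p.1) p.2‖ ^ 2) := by
    refine (summable_prod_of_nonneg fun p => by positivity).2 ⟨fun n => (hs n).summable, ?_⟩
    simp only [(hs _).tsum_eq]
    refine Summable.of_nonneg_of_le (fun n => by positivity) (fun n => ?_)
      (hξ.mul_left (‖C‖ ^ 2))
    rw [← mul_pow]
    gcongr
    exact C.le_opNorm _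
  exact (Equiv.prodComm ι ℕ).summable_iff (f := fun p : ℕ × ι => ‖C (ξ p.1) p.2‖ ^ 2) |>.2 h

variable [CompleteSpace H]

/-- A formal series `∑ i, v i ⊗ w i` with `v i ∈ V`, `w i ∈ W`, such that the series
`∑ i, v i (v i)^*` and `∑ i, (w i)^* w i` converge weak* in `B(H)`. -/
structure Series (V W : Submodule ℂ (H →L[ℂ] H)) : Type (u + 1) where
  ι : Type u
  v : ι → H →L[ℂ] H
  w : ι → H →L[ℂ] H
  v_mem : ∀ i, v i ∈ V
  w_mem : ∀ i, w i ∈ W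
  row : ∃ a, WeakStarHasSum (fun i => v i * star (v i)) a
  col : ∃ b, WeakStarHasSum (fun i => star (w i) * w i) b

lemma hasSum_col {ι : Type*} {w : ι → H →L[ℂ] H} {b : H →L[ℂ] H}
    (hb : WeakStarHasSum (fun i => star (w i) * w i) b) (ξ : H) :
    HasSum (fun i => ‖w i ξ‖ ^ 2) (⟪ξ, b ξ⟫_ℂ).re := by
  have h := Complex.reCLM.hasSum (hb.inner ξ ξ)
  have e : (fun i => ‖w i ξ‖ ^ 2)
      = fun i => Complex.reCLM ⟪ξ, (star (w i) * w i) ξ⟫_ℂ := by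
    funext i
    rw [mul_apply_eq_comp, ContinuousLinearMap.star_eq_adjoint,
      ContinuousLinearMap.adjoint_inner_right, inner_self_eq_norm_sq_to_K, Complex.reCLM_apply]
    norm_cast
  rw [e]
  exact h

/-- The column `(w i)` is a bounded operator from `H` to `ℓ²(ι, H)`. -/
lemma exists_column {ι : Type*} {w : ι → H →L[ℂ] H}
    (hb : ∃ b, WeakStarHasSum (fun i => star (w i) * w i) b) :
    ∃ C : H →L[ℂ] lp (fun _ : ι => H) 2, ∀ ξ i, C ξ i = w i ξ := by
  obtain ⟨b, hb⟩ := hb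
  have hm (ξ : H) : Memℓp (fun i => w i ξ) 2 :=
    memℓp_gen (by simpa using (hasSum_col hb ξ).summable)
  refine ⟨LinearMap.mkContinuous
    { toFun := fun ξ => (⟨fun i => w i ξ, hm ξ⟩ : lp (fun _ : ι => H) 2)
      map_add' := fun x y => by
        ext i
        exact map_add (w i) x y
      map_smul' := fun c x => by
        ext i
        exact map_smul (w i) c x } (Real.sqrt ‖b‖) fun ξ => ?_, fun ξ i => rfl⟩
  refine le_of_sq_le_sq ?_ (by positivity)
  have h1 := lp.norm_rpow_eq_tsum (p := 2) (by norm_num)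
    (⟨fun i => w i ξ, hm ξ⟩ : lp (fun _ : ι => H) 2)
  simp only [ENNReal.toReal_ofNat, Real.rpow_ofNat] at h1
  rw [(hasSum_col hb ξ).tsum_eq] at h1
  have h2 : (⟪ξ, b ξ⟫_ℂ).re ≤ ‖b‖ * ‖ξ‖ ^ 2 := by
    have h3 := (Complex.re_le_norm _).trans (norm_inner_le_norm (𝕜 := ℂ) ξ (b ξ))
    have h4 : ‖ξ‖ * ‖b ξ‖ ≤ ‖ξ‖ * (‖b‖ * ‖ξ‖) := by
      gcongr
      exact b.le_opNorm ξ
    linarith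
  rw [mul_pow, Real.sq_sqrt (norm_nonneg _)]
  exact h1.trans_le h2

/-- For a series `∑ i, v i ⊗ w i` as above, `∑ i, v i * x * w i` converges weak* for every
`x ∈ B(H)`, and the sum is a bounded linear function of `x`. -/
lemma Series.exists_theta {V W : Submodule ℂ (H →L[ℂ] H)} (s : Series V W) :
    ∃ T : (H →L[ℂ] H) →L[ℂ] (H →L[ℂ] H),
      ∀ x, WeakStarHasSum (fun i => s.v i * x * s.w i) (T x) := by
  obtain ⟨R, hR⟩ := exists_column (w := fun i => star (s.v i)) (by simpa using s.row)
  obtain ⟨C, hC⟩ := exists_column s.col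
  let D (x : H →L[ℂ] H) : lp (fun _ : s.ι => H) 2 →L[ℂ] lp (fun _ : s.ι => H) 2 :=
    lp.mapCLM 2 (fun _ => x) (norm_nonneg x) (fun _ => le_rfl)
  have hD (x f i) : D x f i = x (f i) := rfl
  let T : (H →L[ℂ] H) →L[ℂ] (H →L[ℂ] H) := LinearMap.mkContinuous
    { toFun := fun x => (ContinuousLinearMap.adjoint R).comp ((D x).comp C)
      map_add' := fun x y => by
        have : D (x + y) = D x + D y := by ext; simp [hD]
        ext; simp [this]
      map_smul' := fun c x => by
        have : D (c • x) = c • D x := by ext; simp [hD]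
        ext; simp [this] } (‖ContinuousLinearMap.adjoint R‖ * ‖C‖) fun x => by
      have h1 := ContinuousLinearMap.opNorm_comp_le (ContinuousLinearMap.adjoint R) ((D x).comp C)
      have h2 := ContinuousLinearMap.opNorm_comp_le (D x) C
      have h3 : ‖D x‖ ≤ ‖x‖ := lp.norm_mapCLM_le _ _ _ _
      calc _ ≤ ‖ContinuousLinearMap.adjoint R‖ * ‖(D x).comp C‖ := h1
        _ ≤ ‖ContinuousLinearMap.adjoint R‖ * (‖x‖ * ‖C‖) := by
          gcongr
          exact h2.trans (by gcongr)
        _ = _ := by ring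
  refine ⟨T, fun x ξ η hξ hη => ?_⟩
  have hin (η' ξ' : H) : HasSum (fun i => ⟪R η' i, x (C ξ' i)⟫_ℂ) ⟪η', T x ξ'⟫_ℂ := by
    have e : ⟪η', T x ξ'⟫_ℂ = ⟪R η', D x (C ξ')⟫_ℂ :=
      ContinuousLinearMap.adjoint_inner_right R η' (D x (C ξ'))
    rw [e]
    exact lp.hasSum_inner _ _
  have hterm (i : s.ι) (η' ξ' : H) :
      ⟪η', (s.v i * x * s.w i) ξ'⟫_ℂ = ⟪R η' i, x (C ξ' i)⟫_ℂ := by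
    rw [hR, hC, ContinuousLinearMap.star_eq_adjoint, ContinuousLinearMap.adjoint_inner_left]
    rfl
  have hsum : Summable (fun p : s.ι × ℕ => ⟪R (η p.2) p.1, x (C (ξ p.2) p.1)⟫_ℂ) := by
    refine Summable.of_norm_bounded
      (g := fun p : s.ι × ℕ => ‖x‖ * (‖R (η p.2) p.1‖ ^ 2 + ‖C (ξ p.2) p.1‖ ^ 2))
      (((summable_column R hη).add (summable_column C hξ)).mul_left _) fun p => ?_
    have h1 := norm_inner_le_norm (𝕜 := ℂ) (R (η p.2) p.1) (x (C (ξ p.2) p.1))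
    have h2 : ‖R (η p.2) p.1‖ * ‖x (C (ξ p.2) p.1)‖
        ≤ ‖R (η p.2) p.1‖ * (‖x‖ * ‖C (ξ p.2) p.1‖) := by
      gcongr
      exact x.le_opNorm _
    have h3 : 0 ≤ ‖x‖ * (‖R (η p.2) p.1‖ ^ 2 + ‖C (ξ p.2) p.1‖ ^ 2
        - ‖R (η p.2) p.1‖ * ‖C (ξ p.2) p.1‖) :=
      mul_nonneg (norm_nonneg _) (by
        nlinarith [sq_nonneg (‖R (η p.2) p.1‖ - ‖C (ξ p.2) p.1‖),
          sq_nonneg (‖R (η p.2) p.1‖), sq_nonneg (‖C (ξ p.2) p.1‖)])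
    nlinarith
  have hswap := (Equiv.prodComm ℕ s.ι).hasSum_iff.2 hsum.hasSum
  have h1 := hswap.prod_fiberwise fun n => hin (η n) (ξ n)
  have h2 := hsum.hasSum.prod_fiberwise fun i => (hsum.prod_factor i).hasSum
  simp only [normalFunctional, hterm]
  rw [h1.tsum_eq]
  exact h2

/-- The operator `x ↦ ∑ i, v i * x * w i` (weak* convergent sum) on `B(H)` that is given by the
formal series `∑ i, v i ⊗ w i`. -/
def Series.theta {V W : Submodule ℂ (H →L[ℂ] H)} (s : Series V W) :
    (H →L[ℂ] H) →L[ℂ] (H →L[ℂ] H) :=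
  s.exists_theta.choose

lemma Series.theta_spec {V W : Submodule ℂ (H →L[ℂ] H)} (s : Series V W) (x : H →L[ℂ] H) :
    WeakStarHasSum (fun i => s.v i * x * s.w i) (s.theta x) :=
  s.exists_theta.choose_spec x

lemma Series.theta_eq {V W : Submodule ℂ (H →L[ℂ] H)} (s : Series V W)
    {T : (H →L[ℂ] H) →L[ℂ] (H →L[ℂ] H)}
    (h : ∀ x, WeakStarHasSum (fun i => s.v i * x * s.w i) (T x)) : s.theta = T :=
  ContinuousLinearMap.ext fun x => (s.theta_spec x).unique (h x)

/-- The extended Haagerup tensor product `V ⊗^{eh} W`: formal series `∑ i, v i ⊗ w i`, where two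
series are the same element iff they give the same operator `x ↦ ∑ i, v i * x * w i` on `B(H)`.
An element is identified with that operator. -/
def ehTensor (V W : Submodule ℂ (H →L[ℂ] H)) :
    Submodule ℂ ((H →L[ℂ] H) →L[ℂ] (H →L[ℂ] H)) where
  carrier := Set.range (Series.theta : Series V W → _)
  zero_mem' := ⟨⟨PEmpty, PEmpty.elim, PEmpty.elim, fun i => i.elim, fun i => i.elim,
    ⟨0, weakStarHasSum_empty _⟩, ⟨0, weakStarHasSum_empty _⟩⟩,
    Series.theta_eq _ fun _ => weakStarHasSum_empty _⟩
  add_mem' := by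
    rintro _ _ ⟨s, rfl⟩ ⟨t, rfl⟩
    obtain ⟨a, ha⟩ := s.row
    obtain ⟨a', ha'⟩ := t.row
    obtain ⟨b, hb⟩ := s.col
    obtain ⟨b', hb'⟩ := t.col
    exact ⟨⟨s.ι ⊕ t.ι, Sum.elim s.v t.v, Sum.elim s.w t.w,
      fun i => by cases i <;> simp [s.v_mem, t.v_mem],
      fun i => by cases i <;> simp [s.w_mem, t.w_mem],
      ⟨a + a', WeakStarHasSum.sumElim ha ha'⟩, ⟨b + b', WeakStarHasSum.sumElim hb hb'⟩⟩,
      Series.theta_eq _ fun x => WeakStarHasSum.sumElim (s.theta_spec x) (t.theta_spec x)⟩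
  smul_mem' := by
    rintro c _ ⟨s, rfl⟩
    obtain ⟨a, ha⟩ := s.row
    refine ⟨⟨s.ι, fun i => c • s.v i, s.w, fun i => V.smul_mem c (s.v_mem i), s.w_mem,
      ⟨(c * star c) • a, ?_⟩, s.col⟩, Series.theta_eq _ fun x => ?_⟩
    · simpa [smul_smul, mul_comm] using ha.const_smul (c * star c)
    · simpa using (s.theta_spec x).const_smul c

end ExtHaagerup

end

noncomputable section

universe u

namespace ExtHaagerup

variable {H : Type u} [NormedAddCommGroup H] [InnerProductSpace ℂ H]

/-! If `T` and `S` come from `∑ i, v i ⊗ w i` and `∑ j, v' j ⊗ w' j`, then `T * S` should come from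
the double series `∑ (i, j), v i * v' j ⊗ w' j * w i`, whose coefficients lie in the required spaces
by the algebra or module hypotheses. Its weak* convergence to `T (S x)` is a Fubini argument
(`Series.weakStarHasSum_comp`). Paired with a normal functional given by `ξ`, `η`, it becomes a
triple family dominated by the squared norms of `w' j (w i (ξ n))` and `star (v' j) (star (v i) (η
n))`. These are summable because a column is a bounded operator into `ℓ²`, and two columns are
applied in turn. The row and column conditions for the products are the same convergence statement,
applied to `∑ i, (w i)^* ⊗ w i` and evaluated at `x = 1` (`exists_weakStarHasSum_mul`). -/

lemma summable_column_of_index {ι α : Type*} (C : H →L[ℂ] lp (fun _ : ι => H) 2) {ξ : α → H}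
    (hξ : Summable (fun n => ‖ξ n‖ ^ 2)) :
    Summable (fun p : α × ι => ‖C (ξ p.1) p.2‖ ^ 2) := by
  have hs (n : α) : HasSum (fun i => ‖C (ξ n) i‖ ^ 2) (‖C (ξ n)‖ ^ 2) := by
    simpa using lp.hasSum_norm (p := 2) (by norm_num) (C (ξ n))
  refine (summable_prod_of_nonneg fun p => by positivity).2 ⟨fun n => (hs n).summable, ?_⟩
  simp only [(hs _).tsum_eq]
  refine Summable.of_nonneg_of_le (fun n => by positivity) (fun n => ?_) (hξ.mul_left (‖C‖ ^ 2))
  rw [← mul_pow]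
  gcongr
  exact C.le_opNorm _

lemma weakStarHasSum_unique {ι : Type*} [Unique ι] (f : ι → H →L[ℂ] H) :
    WeakStarHasSum f (f default) := fun _ _ _ _ => hasSum_unique _

variable [CompleteSpace H]

/-- The index type of `ξ` is arbitrary so that the lemma can be iterated: its output, indexed by `α
× ι`, is again a valid input. -/
lemma summable_apply_of_weakStarHasSum {ι α : Type*} {w : ι → H →L[ℂ] H}
    (hw : ∃ b, WeakStarHasSum (fun i => star (w i) * w i) b) {ξ : α → H}
    (hξ : Summable (fun n => ‖ξ n‖ ^ 2)) :
    Summable (fun p : α × ι => ‖w p.2 (ξ p.1)‖ ^ 2) := by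
  obtain ⟨C, hC⟩ := exists_column hw
  simpa only [hC] using summable_column_of_index C hξ

lemma inner_conj_apply (a x b : H →L[ℂ] H) (ξ η : H) :
    ⟪η, (a * x * b) ξ⟫_ℂ = ⟪star a η, x (b ξ)⟫_ℂ := by
  rw [ContinuousLinearMap.star_eq_adjoint, ContinuousLinearMap.adjoint_inner_left]
  rfl

/-- Two-sided multiplication moves onto the vectors, so it turns a normal functional into another
one. This lets the weak* sum for the inner series be taken inside each term of the outer one. -/
lemma normalFunctional_conj (a x b : H →L[ℂ] H) (ξ η : ℕ → H) :
    normalFunctional ξ η (a * x * b)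
      = normalFunctional (fun n => b (ξ n)) (fun n => star a (η n)) x := by
  simp only [normalFunctional, inner_conj_apply]

/-! ### Composition of series -/

/-- The composition of two series is given by the double series of products. -/
lemma Series.weakStarHasSum_comp {V W V' W' : Submodule ℂ (H →L[ℂ] H)} (s : Series V W)
    (t : Series V' W') (x : H →L[ℂ] H) :
    WeakStarHasSum (fun p : s.ι × t.ι => (s.v p.1 * t.v p.2) * x * (t.w p.2 * s.w p.1))
      (s.theta (t.theta x)) := by
  intro ξ η hξ hη
  have hs := summable_apply_of_weakStarHasSum s.col hξ
  have hs' := summable_apply_of_weakStarHasSum (w := fun i => star (s.v i))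
    (by simpa using s.row) hη
  -- The second column acts on the family already indexed by `ℕ × s.ι`.
  have ht := summable_apply_of_weakStarHasSum t.col hs
  have ht' := summable_apply_of_weakStarHasSum (w := fun i => star (t.v i))
    (by simpa using t.row) hs'
  have hsum : Summable (fun p : (ℕ × s.ι) × t.ι =>
      ⟪η p.1.1, ((s.v p.1.2 * t.v p.2) * x * (t.w p.2 * s.w p.1.2)) (ξ p.1.1)⟫_ℂ) := by
    refine Summable.of_norm_bounded ((ht'.add ht).mul_left ‖x‖) fun p => ?_
    rw [inner_conj_apply, star_mul]
    refine (norm_inner_le_norm _ _).trans ?_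
    set y := star (t.v p.2) (star (s.v p.1.2) (η p.1.1))
    set z := t.w p.2 (s.w p.1.2 (ξ p.1.1))
    change ‖y‖ * ‖x z‖ ≤ ‖x‖ * (‖y‖ ^ 2 + ‖z‖ ^ 2)
    calc ‖y‖ * ‖x z‖ ≤ ‖y‖ * (‖x‖ * ‖z‖) := by
          gcongr
          exact x.le_opNorm z
      _ = ‖x‖ * (‖y‖ * ‖z‖) := by ring
      _ ≤ ‖x‖ * (‖y‖ ^ 2 + ‖z‖ ^ 2) := by
          gcongr
          nlinarith [sq_nonneg (‖y‖ - ‖z‖), sq_nonneg ‖y‖, sq_nonneg ‖z‖]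
  -- Regrouped with `n` innermost, so that summing over `n` gives `normalFunctional`.
  have hsum' : Summable (fun p : (s.ι × t.ι) × ℕ =>
      ⟪η p.2, ((s.v p.1.1 * t.v p.1.2) * x * (t.w p.1.2 * s.w p.1.1)) (ξ p.2)⟫_ℂ) :=
    hsum.comp_injective (i := fun p : (s.ι × t.ι) × ℕ => ((p.2, p.1.1), p.1.2))
      fun p q h => by simp only [Prod.mk.injEq] at h; grind
  have hprod : Summable (fun p : s.ι × t.ι =>
      normalFunctional ξ η ((s.v p.1 * t.v p.2) * x * (t.w p.2 * s.w p.1))) :=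
    hsum'.prod
  have hfib (i : s.ι) : HasSum (fun j => normalFunctional ξ η
      ((s.v i * t.v j) * x * (t.w j * s.w i)))
      (normalFunctional ξ η (s.v i * t.theta x * s.w i)) := by
    have hξi : Summable (fun n => ‖s.w i (ξ n)‖ ^ 2) :=
      hs.comp_injective (i := fun n => (n, i)) (Prod.mk_left_injective i)
    have hηi : Summable (fun n => ‖star (s.v i) (η n)‖ ^ 2) :=
      hs'.comp_injective (i := fun n => (n, i)) (Prod.mk_left_injective i)
    have h := t.theta_spec x _ _ hξi hηi
    simp only [← normalFunctional_conj] at h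
    simpa only [mul_assoc] using h
  -- The double sum exists unconditionally, so its value is the iterated sum, which `theta_spec` for
  -- the outer series identifies.
  have h := hprod.hasSum.prod_fiberwise hfib
  rw [(s.theta_spec (t.theta x) ξ η hξ hη).unique h]
  exact hprod.hasSum

/-- The series `∑ i, (w i)^* ⊗ w i`. -/
def Series.ofColumn {ι : Type u} (w : ι → H →L[ℂ] H)
    (hw : ∃ a, WeakStarHasSum (fun i => star (w i) * w i) a) :
    Series (⊤ : Submodule ℂ (H →L[ℂ] H)) ⊤ where
  ι := ι
  v i := star (w i)
  w := w
  v_mem _ := trivial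
  w_mem _ := trivial
  row := by simpa using hw
  col := hw

/-- The sum is `∑ i, (b i)^* (∑ j, (w j)^* w j) b i`, the composite of the two operators given by
`Series.ofColumn`, evaluated at `1`. -/
lemma exists_weakStarHasSum_mul {ι κ : Type u} {b : ι → H →L[ℂ] H} {w : κ → H →L[ℂ] H}
    (hb : ∃ a, WeakStarHasSum (fun i => star (b i) * b i) a)
    (hw : ∃ a, WeakStarHasSum (fun j => star (w j) * w j) a) :
    ∃ a, WeakStarHasSum (fun p : ι × κ => star (w p.2 * b p.1) * (w p.2 * b p.1)) a := by
  have h := (Series.ofColumn b hb).weakStarHasSum_comp (Series.ofColumn w hw) 1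
  exact ⟨_, by simpa only [Series.ofColumn, mul_one, star_mul] using h⟩

/-- The double series of products `∑ (i, j), v i * v' j ⊗ w' j * w i`. -/
def Series.comp {V W V' W' V'' W'' : Submodule ℂ (H →L[ℂ] H)}
    (hV : ∀ v ∈ V, ∀ v' ∈ V', v * v' ∈ V'') (hW : ∀ w ∈ W, ∀ w' ∈ W', w' * w ∈ W'')
    (s : Series V W) (t : Series V' W') : Series V'' W'' where
  ι := s.ι × t.ι
  v p := s.v p.1 * t.v p.2
  w p := t.w p.2 * s.w p.1
  v_mem p := hV _ (s.v_mem _) _ (t.v_mem _)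
  w_mem p := hW _ (s.w_mem _) _ (t.w_mem _)
  -- Taking adjoints turns the row condition into a column condition, since `star (v * v') = star v'
  -- * star v`.
  row := by
    simpa using exists_weakStarHasSum_mul (b := fun i => star (s.v i)) (w := fun j => star (t.v j))
      (by simpa using s.row) (by simpa using t.row)
  col := exists_weakStarHasSum_mul s.col t.col

/-- With three independent pairs of spaces, the ambient algebra, the subalgebra and the module
action are all instances. -/
lemma mul_mem_ehTensor {V W V' W' V'' W'' : Submodule ℂ (H →L[ℂ] H)}
    (hV : ∀ v ∈ V, ∀ v' ∈ V', v * v' ∈ V'') (hW : ∀ w ∈ W, ∀ w' ∈ W', w' * w ∈ W'')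
    {T S : (H →L[ℂ] H) →L[ℂ] (H →L[ℂ] H)} (hT : T ∈ ehTensor V W) (hS : S ∈ ehTensor V' W') :
    T * S ∈ ehTensor V'' W'' := by
  obtain ⟨s, rfl⟩ := hT
  obtain ⟨t, rfl⟩ := hS
  exact ⟨s.comp hV hW t, Series.theta_eq _ fun x => s.weakStarHasSum_comp t x⟩

lemma ehTensor_mono {V W V' W' : Submodule ℂ (H →L[ℂ] H)} (hV : V ≤ V') (hW : W ≤ W') :
    ehTensor V W ≤ ehTensor V' W' := by
  rintro _ ⟨s, rfl⟩
  exact ⟨⟨s.ι, s.v, s.w, fun i => hV (s.v_mem i), fun i => hW (s.w_mem i), s.row, s.col⟩,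
    Series.theta_eq _ s.theta_spec⟩

lemma one_mem_ehTensor : (1 : (H →L[ℂ] H) →L[ℂ] (H →L[ℂ] H)) ∈ ehTensor ⊤ ⊤ :=
  ⟨⟨PUnit, fun _ => 1, fun _ => 1, fun _ => trivial, fun _ => trivial,
    ⟨_, weakStarHasSum_unique _⟩, ⟨_, weakStarHasSum_unique _⟩⟩,
    Series.theta_eq _ fun x => by
      simpa using weakStarHasSum_unique fun _ : PUnit => x⟩

end ExtHaagerup

end

theorem proposition2p1 {H : Type*} [NormedAddCommGroup H] [InnerProductSpace ℂ H]
    [CompleteSpace H]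
    (𝔄 𝔅 : NonUnitalSubalgebra ℂ (H →L[ℂ] H))
    (h𝔄 : IsClosed (𝔄 : Set (H →L[ℂ] H))) (h𝔅 : IsClosed (𝔅 : Set (H →L[ℂ] H))) :
    ∃ 𝔈 : Subalgebra ℂ ((H →L[ℂ] H) →L[ℂ] (H →L[ℂ] H)),
      Subalgebra.toSubmodule 𝔈 = ExtHaagerup.ehTensor ⊤ ⊤ ∧
      (∃ 𝔖 : NonUnitalSubalgebra ℂ ((H →L[ℂ] H) →L[ℂ] (H →L[ℂ] H)),
        𝔖.toSubmodule = ExtHaagerup.ehTensor 𝔄.toSubmodule 𝔅.toSubmodule ∧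
        ∀ T ∈ 𝔖, T ∈ 𝔈) ∧
      ∀ 𝔙 𝔚 : Submodule ℂ (H →L[ℂ] H),
        IsClosed (𝔙 : Set (H →L[ℂ] H)) → IsClosed (𝔚 : Set (H →L[ℂ] H)) →
        (∀ a ∈ 𝔄, ∀ v ∈ 𝔙, a * v ∈ 𝔙) → (∀ b ∈ 𝔅, ∀ w ∈ 𝔚, w * b ∈ 𝔚) →
        (∀ S ∈ ExtHaagerup.ehTensor 𝔙 𝔚, S ∈ 𝔈) ∧
        ∀ T ∈ ExtHaagerup.ehTensor 𝔄.toSubmodule 𝔅.toSubmodule,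
          ∀ S ∈ ExtHaagerup.ehTensor 𝔙 𝔚, T * S ∈ ExtHaagerup.ehTensor 𝔙 𝔚 := by
  refine ⟨(ExtHaagerup.ehTensor (H := H) ⊤ ⊤).toSubalgebra ExtHaagerup.one_mem_ehTensor
      fun T S hT hS => ExtHaagerup.mul_mem_ehTensor (fun _ _ _ _ => Submodule.mem_top)
        (fun _ _ _ _ => Submodule.mem_top) hT hS,
    Submodule.toSubalgebra_toSubmodule _ _ _,
    ⟨{ ExtHaagerup.ehTensor 𝔄.toSubmodule 𝔅.toSubmodule with
        -- Composition reverses the order in the second leg, hence `hb'` before `hb`.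
        mul_mem' := fun hT hS => ExtHaagerup.mul_mem_ehTensor (fun _ ha _ ha' => 𝔄.mul_mem ha ha')
          (fun _ hb _ hb' => 𝔅.mul_mem hb' hb) hT hS },
      rfl, fun T hT => ExtHaagerup.ehTensor_mono le_top le_top hT⟩,
    fun 𝔙 𝔚 _ _ h𝔙 h𝔚 => ⟨fun S hS => ExtHaagerup.ehTensor_mono le_top le_top hS,
      fun T hT S hS => ExtHaagerup.mul_mem_ehTensor h𝔙 h𝔚 hT hS⟩⟩
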